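/- Let $e,d\geq 1$ be integers, $T>0$, and $\alpha,\beta\in(0,1]$ with $\alpha+\beta>1$. Let $M_{e,d}(\mathbb R)\cong\mathbb R^{ed}$ be the space of real $e\times d$ matrices with the Euclidean (Frobenius) norm, and let $\mathcal C(\mathbb R^n)$ be the set of nonempty convex compact subsets of $\mathbb R^n$, with the Hausdorff distance $d_H$. For $C\in\mathcal C(\mathbb R^n)$ let $\mathcal T_C$ be the set of $\ell\in\mathbb R^n$ for which $x\mapsto\langle\ell,x\rangle$ attains its maximum over $C$ at exactly one point, denoted $y(\ell,C)$. The Steiner point of $C$ is $\mathrm{St}(C)=\frac1{v_n}\int_{\mathcal T_C\cap B(0,1)}y(x,C)\,dx$, where $v_n$ is the volume of the unit ball $B(0,1)$ of $\mathbb R^n$; $L_n$ is the best Lipschitz constant of $\mathrm{St}:(\mathcal C(\mathbb R^n),d_H)\to\mathbb R^n$; and the Demyanov distance is $d_D(A,B)=\sup\{\|y(\ell,A)-y(\ell,B)\| : \ell\in\mathcal T_A\cap\mathcal T_B\}$. Let $F:[0,T]\to\mathcal C(M_{e,d}(\mathbb R))$ be $\alpha$-Hölder continuous for $d_H$. Put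 $\|F\|_{\infty,T}=\sup_t d_H(F(t),\{0\})$, $\|F\|_{\alpha,T}=\sup_{s<t}d_H(F(s),F(t))/|t-s|^\alpha$, let $\|F\|_{\alpha,T,D}\in[0,\infty]$ be defined likewise with $d_D$ in place of $d_H$, and set $r_{\min}=\min\{L_{ed}\|F\|_{\alpha,T},\ \|F\|_{\alpha,T,D}\}$. For $r\geq 0$ let $\mathcal S_{\alpha,r}(F)$ be the set of measurable $f:[0,T]\to M_{e,d}(\mathbb R)$ with $f(t)\in F(t)$ for all $t$ and with $\alpha$-Hölder seminorm $\|f\|_{\alpha,T}\le r$. For a $\beta$-Hölder continuous $w:[0,T]\to\mathbb R^d$, let $$J_{T,\alpha,r}(F,w)=\Big\{\int_0^T f(t)\,dw(t) : f\in\mathcal S_{\alpha,r}(F)\Big\}\subset\mathbb R^e,$$ where the integrals are Young integrals, i.e. limits of the left-point Riemann sums $\sum_k f(t_k)(w(t_{k+1})-w(t_k))$ as the mesh of the dissection tends to $0$. There is a constant $c_{\alpha,\beta}\geq 1$, depending only on $\alpha$ and $\beta$, for which the Young–Love estimate holds (for all $e,d,T$, all $\alpha$-Hölder $f:[0,T]\to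 M_{e,d}(\mathbb R)$, all $\beta$-Hölder $w:[0,T]\to\mathbb R^d$ and all $0\le s<t\le T$, the Young integral $\int_s^t f\,dw$ exists, is unique, and satisfies $\|\int_s^t f\,dw-f(s)(w(t)-w(s))\|\le c_{\alpha,\beta}\|w\|_{\beta,T}\|f\|_{\alpha,T}|t-s|^{\alpha+\beta}$), and with which the following holds for all $e,d,T,F$ as above. For every $r\geq r_{\min}$ and every $\beta$-Hölder $w:[0,T]\to\mathbb R^d$, the set $J_{T,\alpha,r}(F,w)$ belongs to $\mathcal C(\mathbb R^e)$, and for all $\beta$-Hölder $w^1,w^2:[0,T]\to\mathbb R^d$, $$d_H\big(J_{T,\alpha,r}(F,w^1),J_{T,\alpha,r}(F,w^2)\big)\le c_{\alpha,\beta}\,T^\beta\,(T^\alpha\vee 1)\,(r+\|F\|_{\infty,T})\,\|w^1-w^2\|_{\beta,T},$$ where $\|\cdot\|_{\beta,T}$ is the $\beta$-Hölder seminorm. In particular $w\mapsto J_{T,\alpha,r}(F,w)$ is Lipschitz continuous, with this constant, from the space of $\beta$-Hölder functions with the norm $\|\cdot\|_{\infty,T}+\|\cdot\|_{\beta,T}$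 to $(\mathcal C(\mathbb R^e),d_H)$. -/

import Mathlib

open scoped NNReal ENNReal

noncomputable section

namespace AumannYoung

/-- The Euclidean space `ℝⁿ`. -/
abbrev Vec (n : ℕ) : Type := EuclideanSpace ℝ (Fin n)

/-- Real matrices with `e` rows and `d` columns, identified with `ℝ^{ed}` and hence carrying the
Euclidean (Frobenius) norm. -/
abbrev Mat (e d : ℕ) : Type := EuclideanSpace ℝ (Fin e × Fin d)

/-- The product of a matrix and a vector. -/
def Mat.apply {e d : ℕ} (A : Mat e d) (v : Vec d) : Vec e :=
  WithLp.toLp 2 (fun i => ∑ j, A (i, j) * v j)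

/-! ### Support functions, exposed points, Steiner point and Demyanov distance

`ConvexBody V` is the space of nonempty convex compact subsets of `V` (the interior may be empty),
with the Hausdorff distance as its metric. -/

section Convex

variable {ι : Type} [Fintype ι]

/-- The support function `δ*(ℓ, C)`. -/
def supportFn (l : EuclideanSpace ℝ ι) (C : ConvexBody (EuclideanSpace ℝ ι)) : ℝ :=
  sSup ((fun x => inner ℝ l x) '' (C : Set (EuclideanSpace ℝ ι)))

/-- The face `Y(ℓ, C)` of `C` in the direction `ℓ`. -/
def face (l : EuclideanSpace ℝ ι) (C : ConvexBody (EuclideanSpace ℝ ι)) :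
    Set (EuclideanSpace ℝ ι) :=
  {c | c ∈ C ∧ inner ℝ l c = supportFn l C}

/-- The set `𝒯_C` of the exposing directions of `C`: those `ℓ` for which `Y(ℓ, C)` is a
singleton. -/
def exposingDirs (C : ConvexBody (EuclideanSpace ℝ ι)) : Set (EuclideanSpace ℝ ι) :=
  {l | ∃ c, face l C = {c}}

open Classical in
/-- The exposed point `y(ℓ, C)`, that is the unique element of `Y(ℓ, C)`, for an exposing
direction `ℓ` (and `0` for the other `ℓ`). -/
def exposedPt (l : EuclideanSpace ℝ ι) (C : ConvexBody (EuclideanSpace ℝ ι)) :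
    EuclideanSpace ℝ ι :=
  if h : ∃ c, face l C = {c} then h.choose else 0

/-- The Steiner point: the mean of `y(x, C)` over the unit ball (whose volume is
`π^{n/2} / Γ(1 + n/2)`). -/
def steinerPt (C : ConvexBody (EuclideanSpace ℝ ι)) : EuclideanSpace ℝ ι :=
  (MeasureTheory.volume.real (Metric.closedBall (0 : EuclideanSpace ℝ ι) 1))⁻¹ •
    ∫ x in exposingDirs C ∩ Metric.closedBall 0 1, exposedPt x C

variable (ι) in
/-- The sharp Lipschitz constant of the Steiner point with respect to the Hausdorff distance, on
the space of convex bodies of `ℝ^ι`. -/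
def steinerLip : ℝ≥0∞ :=
  sInf {K : ℝ≥0∞ | ∀ A B : ConvexBody (EuclideanSpace ℝ ι),
    edist (steinerPt A) (steinerPt B) ≤ K * edist A B}

/-- The Demyanov distance, as an extended nonnegative real. -/
def demyanovEDist (A B : ConvexBody (EuclideanSpace ℝ ι)) : ℝ≥0∞ :=
  ⨆ l ∈ exposingDirs A ∩ exposingDirs B, edist (exposedPt l A) (exposedPt l B)

/-- The `α`-Hölder seminorm of `F : [0,T] → cc` for the Demyanov distance; it is `∞` if `F` is not
`α`-Hölder for that distance. -/
def demyanovHolderNorm {T : ℝ} (α : ℝ≥0)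
    (F : Set.Icc (0 : ℝ) T → ConvexBody (EuclideanSpace ℝ ι)) : ℝ≥0∞ :=
  ⨆ (s : Set.Icc (0 : ℝ) T) (t : Set.Icc (0 : ℝ) T) (_ : s < t),
    demyanovEDist (F s) (F t) / edist s t ^ (α : ℝ)

/-- The smallest value `r_min` of the tuning parameter. -/
def rMin {T : ℝ} (α : ℝ≥0)
    (F : Set.Icc (0 : ℝ) T → ConvexBody (EuclideanSpace ℝ ι)) : ℝ≥0∞ :=
  min (steinerLip ι * eHolderNorm α F) (demyanovHolderNorm α F)

/-- `‖F‖_{∞,T} = sup_t d_H(F(t), {0})` (the convex body `0` is `{0}`). -/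
def supNorm {T : ℝ} (F : Set.Icc (0 : ℝ) T → ConvexBody (EuclideanSpace ℝ ι)) : ℝ :=
  ⨆ t, dist (F t) 0

/-- The set `𝒮_{α,r}(F)` of the measurable selections of `F` whose `α`-Hölder seminorm is at
most `r`. -/
def selections {T : ℝ} (α r : ℝ≥0)
    (F : Set.Icc (0 : ℝ) T → ConvexBody (EuclideanSpace ℝ ι)) :
    Set (Set.Icc (0 : ℝ) T → EuclideanSpace ℝ ι) :=
  {f | Measurable f ∧ (∀ t, f t ∈ F t) ∧ eHolderNorm α f ≤ r}

end Convex

/-! ### Young integral -/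

/-- A dissection `s = t₀ < t₁ < ⋯ < tₙ = t` of the interval from `s` to `t`. -/
structure Dissection {X : Type} [Preorder X] (s t : X) where
  n : ℕ
  pt : Fin (n + 1) → X
  strictMono : StrictMono pt
  first : pt 0 = s
  last : pt (Fin.last n) = t

variable {T : ℝ} {e d : ℕ}

/-- The mesh of a dissection. -/
def Dissection.mesh {s t : Set.Icc (0 : ℝ) T} (D : Dissection s t) : ℝ≥0 :=
  Finset.univ.sup fun i : Fin D.n => nndist (D.pt i.castSucc) (D.pt i.succ)

/-- The left-point Riemann sum of `f` with respect to `w` along a dissection. -/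
def youngSum (f : Set.Icc (0 : ℝ) T → Mat e d) (w : Set.Icc (0 : ℝ) T → Vec d)
    {s t : Set.Icc (0 : ℝ) T} (D : Dissection s t) : Vec e :=
  ∑ i : Fin D.n, (f (D.pt i.castSucc)).apply (w (D.pt i.succ) - w (D.pt i.castSucc))

/-- `I` is the Young integral of `f` with respect to `w` from `s` to `t`: the Riemann sums tend to
`I` as the mesh of the dissection tends to `0`. -/
def IsYoungIntegral (f : Set.Icc (0 : ℝ) T → Mat e d) (w : Set.Icc (0 : ℝ) T → Vec d)
    (s t : Set.Icc (0 : ℝ) T) (I : Vec e) : Prop :=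
  Filter.Tendsto (fun D : Dissection s t => youngSum f w D)
    (Filter.comap Dissection.mesh (nhds 0)) (nhds I)

/-- The Aumann-Young integral `J_{T,α,r}(F, w)`: the set of the Young integrals over `[0,T]` of the
elements of `𝒮_{α,r}(F)`. -/
def aumannYoung (hT : 0 ≤ T) (α r : ℝ≥0) (F : Set.Icc (0 : ℝ) T → ConvexBody (Mat e d))
    (w : Set.Icc (0 : ℝ) T → Vec d) : Set (Vec e) :=
  {I | ∃ f ∈ selections α r F, IsYoungIntegral f w ⟨0, le_rfl, hT⟩ ⟨T, hT, le_rfl⟩ I}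

/-- The Hölder norm `N_{β,T}(w) = ‖w‖_{∞,T} + ‖w‖_{β,T}`. -/
def holderFullNorm (β : ℝ≥0) (w : Set.Icc (0 : ℝ) T → Vec d) : ℝ :=
  (⨆ t, ‖w t‖) + nnHolderNorm β w

/-- `c ≥ 1` is a constant for the Young-Love estimate with exponents `α` and `β`, in all dimensions
and on all intervals: the Young integral of `f` with respect to `w` over `[s,t]` exists, is unique,
and satisfies the estimate with constant `c`. -/
def IsYoungLoveConstant (α β : ℝ≥0) (c : ℝ) : Prop :=
  1 ≤ c ∧ ∀ (e d : ℕ) (T : ℝ) (f : Set.Icc (0 : ℝ) T → Mat e d) (w : Set.Icc (0 : ℝ) T → Vec d),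
    MemHolder α f → MemHolder β w → ∀ s t : Set.Icc (0 : ℝ) T, s < t →
      ∃ I : Vec e, IsYoungIntegral f w s t I ∧ (∀ I', IsYoungIntegral f w s t I' → I' = I) ∧
        ‖I - (f s).apply (w t - w s)‖ ≤
          c * nnHolderNorm β w * nnHolderNorm α f * ((t : ℝ) - s) ^ ((α : ℝ) + β)

end AumannYoung

end

noncomputable section

namespace AumannYoung

open MeasureTheory Filter Topology

/-! ### Sewing of almost additive two-parameter functions -/

section Sewing

/-! For `f(s)(w(t) - w(s))`, the defect of additivity is `-(f(u) - f(s))(w(t) - w(u))`, of order `α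
+ β > 1`. The sewing lemma `IsAlmostAdditive.exists_additive` then provides an additive function
close to it. Its increments are the Young integrals: `exists_young` gives the Young-Love estimate
and a rate of convergence of Riemann sums that depends on `f` and `w` only through their Hölder
constants.

The selections with Hölder constant `r` form a convex set, compact for pointwise convergence
(`isCompact_selections`). It is nonempty when `r ≥ r_min`, because the Steiner point is a selection
whose variation is controlled by both the Hausdorff and the Demyanov distance
(`holderWith_steinerPt`). Riemann sums are linear and pointwise continuous in `f` and converge
uniformly on this set, so its image under the integral is convex, compact and nonempty.

For the Lipschitz bound, one selection is integrated against both drivers: the difference is an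
integral against `w₁ - w₂`, to which the Young-Love estimate applies, with `f(0)` bounded by
`‖F‖_{∞,T}` (`dist_integral_le`). -/

/-- The constant in the sewing estimate with exponent `θ > 1`. -/
def sewingConst (θ : ℝ) : ℝ := 2 / (1 - 2 ^ (1 - θ))

lemma two_rpow_one_sub_lt_one {θ : ℝ} (hθ : 1 < θ) : (2 : ℝ) ^ (1 - θ) < 1 :=
  Real.rpow_lt_one_of_one_lt_of_neg one_lt_two (by linarith)

lemma two_le_sewingConst {θ : ℝ} (hθ : 1 < θ) : 2 ≤ sewingConst θ := by
  have h := two_rpow_one_sub_lt_one hθ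
  have h0 : (0 : ℝ) < 2 ^ (1 - θ) := by positivity
  rw [sewingConst, le_div_iff₀ (by linarith)]
  linarith

/-- This fixed-point equation closes the induction by halving: two pieces of at most half the
length, plus two defects. -/
lemma sewingConst_halving {θ : ℝ} (hθ : 1 < θ) :
    2 * sewingConst θ * (1 / 2) ^ θ + 2 = sewingConst θ := by
  have h := two_rpow_one_sub_lt_one hθ
  have h2 : 2 * (1 / 2 : ℝ) ^ θ = 2 ^ (1 - θ) := by
    rw [Real.rpow_sub two_pos, Real.rpow_one, one_div, Real.inv_rpow two_pos.le]
    rfl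
  have h3 : 1 - (2 : ℝ) ^ (1 - θ) ≠ 0 := by linarith
  calc 2 * sewingConst θ * (1 / 2) ^ θ + 2
      = sewingConst θ * (2 * (1 / 2) ^ θ) + 2 := by ring
    _ = sewingConst θ := by rw [h2, sewingConst]; field_simp; ring

variable {T : ℝ} {E : Type*} [NormedAddCommGroup E]

/-- `A` vanishes on the diagonal, and its defect of additivity is of order `θ`. -/
structure IsAlmostAdditive (M θ : ℝ) (A : Set.Icc (0 : ℝ) T → Set.Icc (0 : ℝ) T → E) : Prop where
  nonneg : 0 ≤ M
  one_lt : 1 < θ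
  diag : ∀ x, A x x = 0
  defect : ∀ s u t, s ≤ u → u ≤ t → ‖A s t - A s u - A u t‖ ≤ M * ((t : ℝ) - s) ^ θ

/-- Some step of the chain must cross the midpoint; otherwise the chain would stay below it up to
its end. What remains on either side of that step has at most half the length. -/
lemma exists_halving_index (p : ℕ → ℝ) (hp : Monotone p) {i j : ℕ} (hij : i < j) :
    ∃ k, i ≤ k ∧ k < j ∧ p k ≤ (p i + p j) / 2 ∧ (p i + p j) / 2 ≤ p (k + 1) := by
  by_contra! h
  have hle := hp hij.le
  have key : ∀ k, i ≤ k → k ≤ j → p k ≤ (p i + p j) / 2 := by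
    intro k hk
    induction k, hk using Nat.le_induction with
    | base => intro _; linarith
    | succ k hk ih => intro hkj; exact (h k hk hkj (ih (by omega))).le
  have h1 := h (j - 1) (by omega) (by omega) (key _ (by omega) (by omega))
  rw [Nat.sub_add_cancel (by omega)] at h1
  linarith

lemma rpow_le_half_rpow_mul {x y θ : ℝ} (hθ : 0 ≤ θ) (hx : 0 ≤ x) (h : x ≤ y / 2) :
    x ^ θ ≤ (1 / 2) ^ θ * y ^ θ := by
  rw [← Real.mul_rpow (by norm_num) (by linarith)]
  exact Real.rpow_le_rpow hx (by linarith) hθ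

/-- The sums of an almost additive function along a chain are close to its value at the ends. -/
theorem IsAlmostAdditive.norm_sum_sub_le {M θ : ℝ}
    {A : Set.Icc (0 : ℝ) T → Set.Icc (0 : ℝ) T → E} (hA : IsAlmostAdditive M θ A)
    {p : ℕ → Set.Icc (0 : ℝ) T} (hp : Monotone p) {i j : ℕ} (hij : i ≤ j) :
    ‖∑ k ∈ Finset.Ico i j, A (p k) (p (k + 1)) - A (p i) (p j)‖ ≤
      sewingConst θ * M * ((p j : ℝ) - p i) ^ θ := by
  induction hn : j - i using Nat.strong_induction_on generalizing i j with
  | _ n ih =>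
  subst hn
  have hK := two_le_sewingConst hA.one_lt
  have hM := hA.nonneg
  rcases hij.eq_or_lt with rfl | hlt
  · simp only [Finset.Ico_self, Finset.sum_empty, hA.diag, sub_self, norm_zero]
    positivity
  -- The crossing step from `k` to `k + 1` enters the sum exactly. The two outer chains are handled
  -- by induction, and splitting off `k`, then `k + 1`, costs two defects.
  obtain ⟨k, hik, hkj, h1, h2⟩ := exists_halving_index (fun n => (p n : ℝ)) (fun _ _ h => hp h) hlt
  have m1 : (p i : ℝ) ≤ p k := hp hik
  have m2 : (p k : ℝ) ≤ p (k + 1) := hp k.le_succ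
  have m3 : (p (k + 1) : ℝ) ≤ p j := hp hkj
  have e1 := ih (k - i) (by omega) hik rfl
  have e2 := ih (j - (k + 1)) (by omega) (Nat.succ_le_of_lt hkj) rfl
  have d1 := hA.defect (p i) (p k) (p j) m1 (hp hkj.le)
  have d2 := hA.defect (p k) (p (k + 1)) (p j) m2 m3
  have hθ : 0 ≤ θ := by linarith [hA.one_lt]
  have r1 := rpow_le_half_rpow_mul (x := (p k : ℝ) - p i) (y := (p j : ℝ) - p i) hθ
    (by linarith) (by linarith)
  have r2 := rpow_le_half_rpow_mul (x := (p j : ℝ) - p (k + 1)) (y := (p j : ℝ) - p i) hθ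
    (by linarith) (by linarith)
  have r3 : ((p j : ℝ) - p k) ^ θ ≤ ((p j : ℝ) - p i) ^ θ :=
    Real.rpow_le_rpow (by linarith) (by linarith) hθ
  have hsum : ∑ k ∈ Finset.Ico i j, A (p k) (p (k + 1)) =
      ∑ k ∈ Finset.Ico i k, A (p k) (p (k + 1)) + A (p k) (p (k + 1)) +
        ∑ k ∈ Finset.Ico (k + 1) j, A (p k) (p (k + 1)) := by
    rw [← Finset.sum_Ico_succ_top hik, Finset.sum_Ico_consecutive _ (by omega) (by omega)]
  set S1 := ∑ k ∈ Finset.Ico i k, A (p k) (p (k + 1))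
  set S2 := ∑ k ∈ Finset.Ico (k + 1) j, A (p k) (p (k + 1))
  have hdec : ∑ k ∈ Finset.Ico i j, A (p k) (p (k + 1)) - A (p i) (p j) =
      (S1 - A (p i) (p k)) + (S2 - A (p (k + 1)) (p j)) -
        (A (p i) (p j) - A (p i) (p k) - A (p k) (p j)) -
        (A (p k) (p j) - A (p k) (p (k + 1)) - A (p (k + 1)) (p j)) := by
    rw [hsum]; abel
  have hKM : 0 ≤ sewingConst θ * M := by positivity
  have f1 := mul_le_mul_of_nonneg_left r1 hKM
  have f2 := mul_le_mul_of_nonneg_left r2 hKM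
  have f3 := mul_le_mul_of_nonneg_left r3 hM
  have hfin : sewingConst θ * M * ((p j : ℝ) - p i) ^ θ =
      (2 * sewingConst θ * (1 / 2) ^ θ + 2) * M * ((p j : ℝ) - p i) ^ θ := by
    rw [sewingConst_halving hA.one_lt]
  rw [hdec, hfin]
  refine (norm_sub_le _ _).trans ((add_le_add_left ((norm_sub_le _ _).trans
    (add_le_add_left (norm_add_le _ _) _)) _).trans ?_)
  linarith

/-- On a finite set of points there is an additive function close to an almost additive one. -/
lemma IsAlmostAdditive.exists_on_finset {M θ : ℝ}
    {A : Set.Icc (0 : ℝ) T → Set.Icc (0 : ℝ) T → E} (hA : IsAlmostAdditive M θ A)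
    (o : Set.Icc (0 : ℝ) T) (P : Finset (Set.Icc (0 : ℝ) T)) :
    ∃ Φ : Set.Icc (0 : ℝ) T → E, Φ o = 0 ∧ ∀ s ∈ P, ∀ t ∈ P, s ≤ t →
      ‖Φ t - Φ s - A s t‖ ≤ sewingConst θ * M * ((t : ℝ) - s) ^ θ := by
  rcases P.eq_empty_or_nonempty with rfl | hP
  · exact ⟨0, by simp⟩
  have hc : 0 < P.card := hP.card_pos
  -- Truncating the index makes the increasing enumeration of `P` a monotone sequence on all of `ℕ`,
  -- constant from the last point on.
  set p : ℕ → Set.Icc (0 : ℝ) T := fun k =>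
    P.orderEmbOfFin rfl ⟨min k (P.card - 1), by omega⟩ with hpdef
  have hp : Monotone p := fun a b hab => by
    apply (P.orderEmbOfFin rfl).monotone
    simp only [Fin.mk_le_mk]
    omega
  have hsurj : ∀ x ∈ P, ∃ k, p k = x := by
    intro x hx
    have : x ∈ Set.range (P.orderEmbOfFin rfl) := by
      rw [Finset.range_orderEmbOfFin]; exact hx
    obtain ⟨⟨k, hk⟩, rfl⟩ := this
    exact ⟨k, by simp only [hpdef]; congr 2; omega⟩
  classical
  choose! κ hκ using hsurj
  -- Partial sums along the chain, normalised to vanish at `o`; this normalisation later bounds the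
  -- values uniformly in `P`.
  refine ⟨fun x => ∑ k ∈ Finset.range (κ x), A (p k) (p (k + 1)) -
    ∑ k ∈ Finset.range (κ o), A (p k) (p (k + 1)), sub_self _, fun s hs t ht hst => ?_⟩
  have hK := two_le_sewingConst hA.one_lt
  have hM := hA.nonneg
  rcases hst.eq_or_lt with rfl | hlt
  · simp only [sub_self, hA.diag, norm_zero]
    positivity
  have hle : κ s ≤ κ t := by
    by_contra h
    have := hp (not_le.1 h).le
    rw [hκ s hs, hκ t ht] at this
    exact absurd hlt (not_lt.2 this)
  have := hA.norm_sum_sub_le hp hle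
  rw [hκ s hs, hκ t ht, Finset.sum_Ico_eq_sub _ hle] at this
  simpa using this

/-- **Sewing lemma**: an almost additive function is close to an additive one. -/
theorem IsAlmostAdditive.exists_additive [ProperSpace E] {M θ : ℝ}
    {A : Set.Icc (0 : ℝ) T → Set.Icc (0 : ℝ) T → E} (hA : IsAlmostAdditive M θ A) :
    ∃ Φ : Set.Icc (0 : ℝ) T → E, ∀ s t, s ≤ t →
      ‖Φ t - Φ s - A s t‖ ≤ sewingConst θ * M * ((t : ℝ) - s) ^ θ := by
  rcases isEmpty_or_nonempty (Set.Icc (0 : ℝ) T) with he | ⟨⟨o⟩⟩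
  · exact ⟨0, fun s => isEmptyElim s⟩
  classical
  choose Φ hΦ0 hΦ using hA.exists_on_finset o
  -- Along an ultrafilter of growing finite sets, the bounded values `Φ P x` converge at all points
  -- `x` simultaneously, and the estimate passes to the limit.
  let U : Ultrafilter (Finset (Set.Icc (0 : ℝ) T)) := Ultrafilter.of atTop
  have hU : ∀ x, ∀ᶠ P in (U : Filter (Finset (Set.Icc (0 : ℝ) T))), x ∈ P := fun x => by
    have : ∀ᶠ P in (atTop : Filter (Finset (Set.Icc (0 : ℝ) T))), x ∈ P := by
      filter_upwards [eventually_ge_atTop {x}] with P hP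
      exact hP (Finset.mem_singleton_self x)
    exact this.filter_mono (Ultrafilter.of_le _)
  have hlim : ∀ x, ∃ y, Tendsto (fun P => Φ P x) U (𝓝 y) := by
    intro x
    have hb : ∃ R, ∀ᶠ P in (U : Filter (Finset (Set.Icc (0 : ℝ) T))), ‖Φ P x‖ ≤ R := by
      rcases le_total o x with h | h
      · refine ⟨sewingConst θ * M * ((x : ℝ) - o) ^ θ + ‖A o x‖, ?_⟩
        filter_upwards [hU o, hU x] with P ho hx
        have h1 := hΦ P o ho x hx h
        rw [hΦ0, sub_zero] at h1
        linarith [norm_sub_norm_le (Φ P x) (A o x)]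
      · refine ⟨sewingConst θ * M * ((o : ℝ) - x) ^ θ + ‖A x o‖, ?_⟩
        filter_upwards [hU o, hU x] with P ho hx
        have h1 := hΦ P x hx o ho h
        rw [hΦ0, zero_sub, ← norm_neg, neg_sub, sub_neg_eq_add, add_comm] at h1
        linarith [norm_sub_norm_le (Φ P x) (-A x o), norm_neg (A x o),
          congrArg norm (sub_neg_eq_add (Φ P x) (A x o))]
    obtain ⟨R, hR⟩ := hb
    obtain ⟨y, -, hy⟩ := (isCompact_closedBall (0 : E) R).ultrafilter_le_nhds
      (U.map fun P => Φ P x) (le_principal_iff.2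
        (hR.mono fun P hP => mem_closedBall_zero_iff.2 hP))
    exact ⟨y, hy⟩
  choose Ψ hΨ using hlim
  refine ⟨Ψ, fun s t hst => ?_⟩
  refine le_of_tendsto (((hΨ t).sub (hΨ s)).sub_const (A s t)).norm ?_
  filter_upwards [hU s, hU t] with P hs ht
  exact hΦ P s hs t ht hst

end Sewing

/-! ### Exposed points and the Steiner point -/

section Steiner

variable {ι : Type} [Fintype ι]

lemma bddAbove_inner_image (l : EuclideanSpace ℝ ι) (C : ConvexBody (EuclideanSpace ℝ ι)) :
    BddAbove ((fun x => inner ℝ l x) '' (C : Set (EuclideanSpace ℝ ι))) :=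
  (C.isCompact.image (continuous_const.inner continuous_id)).bddAbove

lemma inner_le_supportFn (l : EuclideanSpace ℝ ι) {C : ConvexBody (EuclideanSpace ℝ ι)}
    {c : EuclideanSpace ℝ ι} (hc : c ∈ C) : inner ℝ l c ≤ supportFn l C :=
  le_csSup (bddAbove_inner_image l C) ⟨c, hc, rfl⟩

lemma face_nonempty (l : EuclideanSpace ℝ ι) (C : ConvexBody (EuclideanSpace ℝ ι)) :
    (face l C).Nonempty := by
  obtain ⟨c, hc, h⟩ := (C.isCompact.image (continuous_const.inner continuous_id)).sSup_mem
    (C.nonempty.image (fun x => inner ℝ l x))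
  exact ⟨c, hc, h⟩

/-- A maximiser for `l` is tested against `l'`, with the radius of a ball containing `C` as
constant. This makes Rademacher's theorem available. -/
lemma exists_lipschitzWith_supportFn (C : ConvexBody (EuclideanSpace ℝ ι)) :
    ∃ K : ℝ≥0, LipschitzWith K (fun l => supportFn l C) := by
  obtain ⟨R, hR⟩ := C.isBounded.exists_norm_le
  refine ⟨R.toNNReal, LipschitzWith.of_le_add_mul _ fun l l' => ?_⟩
  obtain ⟨c, hc, h⟩ := face_nonempty l C
  have h1 := inner_le_supportFn l' hc
  have h2 : inner ℝ (l - l') c ≤ ‖l - l'‖ * ‖c‖ := real_inner_le_norm _ _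
  rw [inner_sub_left] at h2
  have h3 : ‖l - l'‖ * ‖c‖ ≤ R.toNNReal * dist l l' := by
    rw [dist_eq_norm, mul_comm]
    gcongr
    exact (hR c hc).trans (Real.le_coe_toNNReal R)
  linarith

/-- Where the support function is differentiable, its gradient is the only point of the face. -/
lemma face_eq_singleton_gradient {l : EuclideanSpace ℝ ι} {C : ConvexBody (EuclideanSpace ℝ ι)}
    (h : DifferentiableAt ℝ (fun l => supportFn l C) l) :
    face l C = {gradient (fun l => supportFn l C) l} := by
  refine Set.eq_singleton_iff_nonempty_unique_mem.2 ⟨face_nonempty l C, fun c hc => ?_⟩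
  have hd : HasFDerivAt (fun l' => supportFn l' C - inner ℝ c l')
      (fderiv ℝ (fun l => supportFn l C) l - innerSL ℝ c) l :=
    h.hasFDerivAt.sub (innerSL ℝ c).hasFDerivAt
  -- Any `c` in the face touches the support function from below at `l`, so the two derivatives
  -- agree there.
  have hmin : IsLocalMin (fun l' => supportFn l' C - inner ℝ c l') l := by
    refine Eventually.of_forall fun l' => ?_
    simp only [real_inner_comm _ c, hc.2, sub_self, sub_nonneg]
    exact inner_le_supportFn l' hc.1
  have h0 := sub_eq_zero.1 (hmin.hasFDerivAt_eq_zero hd)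
  rw [gradient, h0]
  exact ((InnerProductSpace.toDual ℝ _).symm_apply_apply c).symm

lemma exposedPt_eq_of_face_eq {l c : EuclideanSpace ℝ ι} {C : ConvexBody (EuclideanSpace ℝ ι)}
    (h : face l C = {c}) : exposedPt l C = c := by
  have h' : ∃ c, face l C = {c} := ⟨c, h⟩
  rw [exposedPt, dif_pos h']
  exact (Set.singleton_injective (h.symm.trans h'.choose_spec)).symm

lemma exposedPt_mem {l : EuclideanSpace ℝ ι} {C : ConvexBody (EuclideanSpace ℝ ι)}
    (h : l ∈ exposingDirs C) : exposedPt l C ∈ (C : Set (EuclideanSpace ℝ ι)) := by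
  obtain ⟨c, hc⟩ := h
  rw [exposedPt_eq_of_face_eq hc]
  exact (hc.ge rfl : c ∈ face l C).1

lemma ae_face_eq_gradient (C : ConvexBody (EuclideanSpace ℝ ι)) :
    ∀ᵐ l, face l C = {gradient (fun l => supportFn l C) l} := by
  obtain ⟨K, hK⟩ := exists_lipschitzWith_supportFn C
  filter_upwards [hK.ae_differentiableAt] with l hl using face_eq_singleton_gradient hl

lemma ae_mem_exposingDirs (C : ConvexBody (EuclideanSpace ℝ ι)) : ∀ᵐ l, l ∈ exposingDirs C := by
  filter_upwards [ae_face_eq_gradient C] with l hl using ⟨_, hl⟩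

/-- Almost everywhere the exposed point is a gradient, and derivatives are measurable. -/
lemma aestronglyMeasurable_exposedPt (C : ConvexBody (EuclideanSpace ℝ ι)) :
    AEStronglyMeasurable (fun l => exposedPt l C) volume := by
  refine AEStronglyMeasurable.congr (f := gradient fun l => supportFn l C) ?_ ?_
  · exact ((InnerProductSpace.toDual ℝ _).symm.continuous.measurable.comp
      (measurable_fderiv ℝ _)).aestronglyMeasurable
  · filter_upwards [ae_face_eq_gradient C] with l hl using (exposedPt_eq_of_face_eq hl).symm

lemma integrableOn_exposedPt (C : ConvexBody (EuclideanSpace ℝ ι)) :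
    IntegrableOn (fun l => exposedPt l C) (Metric.closedBall 0 1) := by
  obtain ⟨R, hR⟩ := C.isBounded.exists_norm_le
  refine Measure.integrableOn_of_bounded (M := R) measure_closedBall_lt_top.ne
    (aestronglyMeasurable_exposedPt C) (ae_restrict_of_ae ?_)
  filter_upwards [ae_mem_exposingDirs C] with l hl using hR _ (exposedPt_mem hl)

/-- The Steiner point is the average of the exposed points over the unit ball. -/
lemma steinerPt_eq_average (C : ConvexBody (EuclideanSpace ℝ ι)) :
    steinerPt C = ⨍ x in Metric.closedBall (0 : EuclideanSpace ℝ ι) 1, exposedPt x C := by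
  rw [steinerPt, setAverage_eq]
  congr 1
  refine setIntegral_congr_set ?_
  filter_upwards [ae_mem_exposingDirs C] with l hl
  exact propext ⟨fun h => h.2, fun h => ⟨hl, h⟩⟩

lemma volume_closedBall_ne_zero :
    volume (Metric.closedBall (0 : EuclideanSpace ℝ ι) 1) ≠ 0 :=
  (Metric.measure_closedBall_pos _ _ one_pos).ne'

lemma steinerPt_mem (C : ConvexBody (EuclideanSpace ℝ ι)) : steinerPt C ∈ C := by
  rw [steinerPt_eq_average]
  refine C.convex.set_average_mem C.isClosed volume_closedBall_ne_zero
    measure_closedBall_lt_top.ne (ae_restrict_of_ae ?_) (integrableOn_exposedPt C)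
  filter_upwards [ae_mem_exposingDirs C] with l hl using exposedPt_mem hl

/-- The difference of the Steiner points is the average of the differences of exposed points, almost
all of which lie in the closed ball whose radius is the Demyanov distance. -/
lemma edist_steinerPt_le_demyanovEDist (A B : ConvexBody (EuclideanSpace ℝ ι)) :
    edist (steinerPt A) (steinerPt B) ≤ demyanovEDist A B := by
  rcases eq_or_ne (demyanovEDist A B) ∞ with h | h
  · rw [h]; exact le_top
  have hb : ∀ᵐ l, ‖exposedPt l A - exposedPt l B‖ ≤ (demyanovEDist A B).toReal := by
    filter_upwards [ae_mem_exposingDirs A, ae_mem_exposingDirs B] with l hA hB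
    rw [← dist_eq_norm, dist_edist]
    exact ENNReal.toReal_mono h (le_iSup₂ (f := fun l _ => edist (exposedPt l A) (exposedPt l B))
      l ⟨hA, hB⟩)
  have hmem := (convex_closedBall (0 : EuclideanSpace ℝ ι) (demyanovEDist A B).toReal).set_average_mem
    Metric.isClosed_closedBall volume_closedBall_ne_zero
    (measure_closedBall_lt_top (x := (0 : EuclideanSpace ℝ ι)) (r := 1)).ne (ae_restrict_of_ae (by
      filter_upwards [hb] with l hl
      simpa using hl)) ((integrableOn_exposedPt A).sub (integrableOn_exposedPt B))
  rw [edist_dist, steinerPt_eq_average, steinerPt_eq_average]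
  refine ENNReal.ofReal_le_of_le_toReal ?_
  rw [dist_eq_norm]
  simp only [setAverage_eq] at hmem ⊢
  simp only [Pi.sub_apply] at hmem
  rw [integral_sub (integrableOn_exposedPt A) (integrableOn_exposedPt B), smul_sub] at hmem
  simpa using hmem

/-- The infimum defining `steinerLip` is itself an admissible constant. -/
lemma edist_steinerPt_le (A B : ConvexBody (EuclideanSpace ℝ ι)) :
    edist (steinerPt A) (steinerPt B) ≤ steinerLip ι * edist A B := by
  rcases eq_or_ne (edist A B) 0 with h | h
  · rw [edist_eq_zero.1 h, edist_self]; exact zero_le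
  rw [← ENNReal.div_le_iff h (edist_ne_top A B)]
  refine le_sInf fun K hK => ?_
  rw [ENNReal.div_le_iff h (edist_ne_top A B)]
  exact hK A B

lemma edist_le_eHolderNorm_mul {X Y : Type*} [MetricSpace X] [EMetricSpace Y] {α : ℝ≥0}
    {f : X → Y} (hf : MemHolder α f) (s t : X) :
    edist (f s) (f t) ≤ eHolderNorm α f * edist s t ^ (α : ℝ) := by
  rw [← hf.coe_nnHolderNorm_eq_eHolderNorm]
  exact hf.holderWith s t

lemma demyanovEDist_le_demyanovHolderNorm_mul {T : ℝ} (α : ℝ≥0)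
    (F : Set.Icc (0 : ℝ) T → ConvexBody (EuclideanSpace ℝ ι)) {s t : Set.Icc (0 : ℝ) T}
    (hst : s < t) :
    demyanovEDist (F s) (F t) ≤ demyanovHolderNorm α F * edist s t ^ (α : ℝ) := by
  have h0 : edist s t ≠ 0 := by simpa using hst.ne
  rw [← ENNReal.div_le_iff (by simp [ENNReal.rpow_eq_zero_iff, h0, edist_ne_top])
    (ENNReal.rpow_ne_top_of_nonneg α.coe_nonneg (edist_ne_top s t))]
  exact le_iSup_of_le s (le_iSup_of_le t (le_iSup_of_le hst le_rfl))

/-- The Steiner selection is Hölder continuous with any constant `r ≥ r_min`. -/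
theorem holderWith_steinerPt {T : ℝ} {α r : ℝ≥0}
    {F : Set.Icc (0 : ℝ) T → ConvexBody (EuclideanSpace ℝ ι)} (hF : MemHolder α F)
    (hr : rMin α F ≤ r) : HolderWith r α fun t => steinerPt (F t) := by
  have key : ∀ s t : Set.Icc (0 : ℝ) T, s < t →
      edist (steinerPt (F s)) (steinerPt (F t)) ≤ r * edist s t ^ (α : ℝ) := by
    intro s t hst
    rcases min_le_iff.1 hr with h | h
    · refine (edist_steinerPt_le _ _).trans (le_trans ?_ (mul_le_mul_left h _))
      rw [mul_assoc]
      exact mul_le_mul_right (edist_le_eHolderNorm_mul hF s t) _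
    · exact (edist_steinerPt_le_demyanovEDist _ _).trans
        ((demyanovEDist_le_demyanovHolderNorm_mul α F hst).trans (mul_le_mul_left h _))
  intro s t
  rcases lt_trichotomy s t with h | rfl | h
  · exact key s t h
  · simp
  · rw [edist_comm, edist_comm s]
    exact key t s h

end Steiner

/-! ### Young integration -/

section Young

variable {T : ℝ} {e d : ℕ}

lemma Mat.apply_sub_right (A : Mat e d) (v w : Vec d) :
    A.apply (v - w) = A.apply v - A.apply w := by
  ext i
  simp [Mat.apply, mul_sub, Finset.sum_sub_distrib]

lemma Mat.apply_sub_left (A B : Mat e d) (v : Vec d) :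
    Mat.apply (A - B) v = A.apply v - B.apply v := by
  ext i
  simp [Mat.apply, sub_mul, Finset.sum_sub_distrib]

lemma Mat.apply_combination (a b : ℝ) (A B : Mat e d) (v : Vec d) :
    Mat.apply (a • A + b • B) v = a • A.apply v + b • B.apply v := by
  ext i
  simp [Mat.apply, add_mul, Finset.sum_add_distrib, Finset.mul_sum, mul_assoc]

lemma Mat.norm_apply_le (A : Mat e d) (v : Vec d) : ‖A.apply v‖ ≤ ‖A‖ * ‖v‖ := by
  refine le_of_sq_le_sq ?_ (by positivity)
  rw [mul_pow, EuclideanSpace.real_norm_sq_eq, EuclideanSpace.real_norm_sq_eq,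
    EuclideanSpace.real_norm_sq_eq, Fintype.sum_prod_type, Finset.sum_mul]
  exact Finset.sum_le_sum fun i _ =>
    Finset.sum_mul_sq_le_sq_mul_sq Finset.univ (fun j => A (i, j)) fun j => v j

lemma Mat.continuous_apply (v : Vec d) : Continuous fun A : Mat e d => A.apply v := by
  unfold Mat.apply
  fun_prop

lemma dist_eq_sub {s t : Set.Icc (0 : ℝ) T} (h : s ≤ t) : dist s t = (t : ℝ) - s := by
  rw [dist_comm, Subtype.dist_eq, Real.dist_eq, abs_of_nonneg]
  exact sub_nonneg.2 (show (s : ℝ) ≤ t from h)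

lemma norm_sub_le_of_holderWith {V : Type*} [NormedAddCommGroup V] {C γ : ℝ≥0}
    {f : Set.Icc (0 : ℝ) T → V} (hf : HolderWith C γ f) {s t : Set.Icc (0 : ℝ) T} (h : s ≤ t) :
    ‖f t - f s‖ ≤ C * ((t : ℝ) - s) ^ (γ : ℝ) := by
  rw [← dist_eq_norm, dist_comm, ← dist_eq_sub h]
  exact hf.dist_le s t

lemma isAlmostAdditive_apply {α β Cf Cw : ℝ≥0} (hαβ : 1 < α + β)
    {f : Set.Icc (0 : ℝ) T → Mat e d} {w : Set.Icc (0 : ℝ) T → Vec d}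
    (hf : HolderWith Cf α f) (hw : HolderWith Cw β w) :
    IsAlmostAdditive ((Cf : ℝ) * Cw) ((α : ℝ) + β) fun s t => (f s).apply (w t - w s) where
  nonneg := by positivity
  one_lt := by exact_mod_cast hαβ
  diag x := by rw [Mat.apply_sub_right, sub_self]
  defect s u t hsu hut := by
    have h : (f s).apply (w t - w s) - (f s).apply (w u - w s) - (f u).apply (w t - w u) =
        -Mat.apply (f u - f s) (w t - w u) := by
      rw [Mat.apply_sub_left]
      simp only [Mat.apply_sub_right]
      abel
    have h1 : (s : ℝ) ≤ u := hsu
    have h2 : (u : ℝ) ≤ t := hut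
    have hpos : 0 < (α : ℝ) + β := zero_lt_one.trans (by exact_mod_cast hαβ)
    rw [h, norm_neg, Real.rpow_add_of_nonneg (by linarith) α.coe_nonneg β.coe_nonneg]
    refine (Mat.norm_apply_le _ _).trans ?_
    calc ‖f u - f s‖ * ‖w t - w u‖
        ≤ (Cf * ((u : ℝ) - s) ^ (α : ℝ)) * (Cw * ((t : ℝ) - u) ^ (β : ℝ)) :=
          mul_le_mul (norm_sub_le_of_holderWith hf hsu) (norm_sub_le_of_holderWith hw hut)
            (norm_nonneg _) (mul_nonneg Cf.2 (Real.rpow_nonneg (by linarith) _))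
      _ ≤ (Cf * ((t : ℝ) - s) ^ (α : ℝ)) * (Cw * ((t : ℝ) - s) ^ (β : ℝ)) := by
          have h3 : 0 ≤ (t : ℝ) - s := by linarith
          gcongr
      _ = _ := by ring

lemma sum_fin_sub {V : Type*} [AddCommGroup V] :
    ∀ (n : ℕ) (g : Fin (n + 1) → V),
      ∑ i : Fin n, (g i.succ - g i.castSucc) = g (Fin.last n) - g 0
  | 0, g => by simp
  | n + 1, g => by
    rw [Fin.sum_univ_castSucc, Fin.succ_last]
    have := sum_fin_sub n fun i => g i.castSucc
    simp only [← Fin.succ_castSucc, Fin.castSucc_zero] at this ⊢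
    rw [this]
    abel

/-- The Young integral, with a rate for the convergence of the Riemann sums and the Young-Love
estimate. -/
theorem exists_young {α β Cf Cw : ℝ≥0} (hαβ : 1 < α + β)
    {f : Set.Icc (0 : ℝ) T → Mat e d} {w : Set.Icc (0 : ℝ) T → Vec d}
    (hf : HolderWith Cf α f) (hw : HolderWith Cw β w) {s t : Set.Icc (0 : ℝ) T} (hst : s ≤ t) :
    ∃ I : Vec e,
      (∀ D : Dissection s t, ‖youngSum f w D - I‖ ≤
        sewingConst (α + β) * (Cf * Cw) * ((t : ℝ) - s) * (D.mesh : ℝ) ^ ((α : ℝ) + β - 1)) ∧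
      ‖I - (f s).apply (w t - w s)‖ ≤
        sewingConst (α + β) * (Cf * Cw) * ((t : ℝ) - s) ^ ((α : ℝ) + β) := by
  have hA := isAlmostAdditive_apply hαβ hf hw
  obtain ⟨Φ, hΦ⟩ := hA.exists_additive
  refine ⟨Φ t - Φ s, fun D => ?_, hΦ s t hst⟩
  have hK := two_le_sewingConst hA.one_lt
  have hθ := hA.one_lt
  -- Telescoping both `Φ t - Φ s` and `t - s` along `D` reduces the claim to one interval: one power
  -- of its length sums to `t - s`, and the mesh bounds the remaining power.
  have htel := sum_fin_sub D.n fun i => Φ (D.pt i)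
  have htel' := sum_fin_sub D.n fun i => (D.pt i : ℝ)
  rw [D.first, D.last] at htel htel'
  rw [← htel, ← htel', youngSum, ← Finset.sum_sub_distrib, Finset.mul_sum, Finset.sum_mul]
  refine norm_sum_le_of_le _ fun i _ => ?_
  have hlt : D.pt i.castSucc < D.pt i.succ := D.strictMono i.castSucc_lt_succ
  have hlt' : (D.pt i.castSucc : ℝ) < D.pt i.succ := hlt
  have hm : (D.pt i.succ : ℝ) - D.pt i.castSucc ≤ D.mesh := by
    rw [← dist_eq_sub hlt.le]
    exact_mod_cast Finset.le_sup (f := fun i : Fin D.n => nndist (D.pt i.castSucc) (D.pt i.succ))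
      (Finset.mem_univ i)
  rw [norm_sub_rev]
  refine (hΦ _ _ hlt.le).trans ?_
  have hsplit : ((D.pt i.succ : ℝ) - D.pt i.castSucc) ^ ((α : ℝ) + β) =
      ((D.pt i.succ : ℝ) - D.pt i.castSucc) *
        ((D.pt i.succ : ℝ) - D.pt i.castSucc) ^ ((α : ℝ) + β - 1) := by
    rw [← Real.rpow_one_add' (by linarith) (by linarith)]
    congr 1
    ring
  rw [hsplit, ← mul_assoc]
  have hpow : ((D.pt i.succ : ℝ) - D.pt i.castSucc) ^ ((α : ℝ) + β - 1) ≤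
      (D.mesh : ℝ) ^ ((α : ℝ) + β - 1) :=
    Real.rpow_le_rpow (by linarith) hm (by linarith)
  refine mul_le_mul_of_nonneg_left hpow ?_
  have := sub_nonneg.2 hlt'.le
  positivity

/-- The filter of dissections of vanishing mesh. -/
abbrev meshFilter (s t : Set.Icc (0 : ℝ) T) : Filter (Dissection s t) :=
  comap Dissection.mesh (𝓝 0)

lemma tendsto_mesh_rpow (s t : Set.Icc (0 : ℝ) T) {γ : ℝ} (hγ : 0 < γ) (C : ℝ) :
    Tendsto (fun D : Dissection s t => C * (D.mesh : ℝ) ^ γ) (meshFilter s t) (𝓝 0) := by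
  have h : Tendsto (fun D : Dissection s t => (D.mesh : ℝ)) (meshFilter s t) (𝓝 0) :=
    NNReal.tendsto_coe.2 tendsto_comap
  have h2 := (h.rpow_const (p := γ) (Or.inr hγ.le)).const_mul C
  rwa [Real.zero_rpow hγ.ne', mul_zero] at h2

/-- The dissection into `n + 1` pieces of equal length. -/
def uniformDissection {s t : Set.Icc (0 : ℝ) T} (hst : s < t) (n : ℕ) : Dissection s t where
  n := n + 1
  pt i := ⟨AffineMap.lineMap (s : ℝ) (t : ℝ) ((i : ℝ) / (n + 1)),
    (convex_Icc (0 : ℝ) T).lineMap_mem s.2 t.2 ⟨by positivity, by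
      rw [div_le_one (by positivity)]
      exact_mod_cast Nat.lt_succ_iff.1 i.2⟩⟩
  strictMono i j hij := by
    have hst' : (s : ℝ) < t := hst
    have hij' : (i : ℝ) < j := by exact_mod_cast hij
    rw [Subtype.mk_lt_mk, lineMap_lt_lineMap_iff_of_lt' hst']
    gcongr
  first := by simp
  last := by
    ext
    have : ((n : ℝ) + 1) ≠ 0 := by positivity
    simp [this]

lemma mesh_uniformDissection_le {s t : Set.Icc (0 : ℝ) T} (hst : s < t) (n : ℕ) :
    (uniformDissection hst n).mesh ≤ nndist s t * (1 / ((n : ℝ≥0) + 1)) := by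
  refine Finset.sup_le fun (i : Fin (n + 1)) _ => ?_
  rw [← NNReal.coe_le_coe, coe_nndist, Subtype.dist_eq]
  change dist (AffineMap.lineMap (s : ℝ) (t : ℝ) (((i : ℕ) : ℝ) / (n + 1)))
    (AffineMap.lineMap (s : ℝ) (t : ℝ) (((i + 1 : ℕ) : ℝ) / (n + 1))) ≤ _
  rw [dist_lineMap_lineMap, Real.dist_eq, ← sub_div]
  push_cast
  rw [sub_add_cancel_left, abs_div, abs_neg, abs_one, abs_of_nonneg (by positivity), mul_comm]
  rfl

/-- Uniform dissections have arbitrarily small mesh; this is what makes Young integrals unique. -/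
lemma meshFilter_neBot {s t : Set.Icc (0 : ℝ) T} (hst : s < t) : (meshFilter s t).NeBot := by
  have h : Tendsto (fun n => (uniformDissection hst n).mesh) atTop (𝓝 0) := by
    refine tendsto_of_tendsto_of_tendsto_of_le_of_le tendsto_const_nhds ?_ (fun _ => zero_le)
      (mesh_uniformDissection_le hst)
    simpa using (tendsto_one_div_add_atTop_nhds_zero_nat (𝕜 := ℝ≥0)).const_mul (nndist s t)
  have h' : Tendsto (uniformDissection hst) atTop (meshFilter s t) := tendsto_comap_iff.2 h
  exact h'.neBot

lemma IsYoungIntegral.unique {f : Set.Icc (0 : ℝ) T → Mat e d} {w : Set.Icc (0 : ℝ) T → Vec d}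
    {s t : Set.Icc (0 : ℝ) T} (hst : s < t) {I I' : Vec e} (h : IsYoungIntegral f w s t I)
    (h' : IsYoungIntegral f w s t I') : I = I' :=
  have := meshFilter_neBot hst
  tendsto_nhds_unique h h'

lemma isYoungIntegral_of_rate {f : Set.Icc (0 : ℝ) T → Mat e d} {w : Set.Icc (0 : ℝ) T → Vec d}
    {s t : Set.Icc (0 : ℝ) T} {I : Vec e} {C γ : ℝ} (hγ : 0 < γ)
    (h : ∀ D : Dissection s t, ‖youngSum f w D - I‖ ≤ C * (D.mesh : ℝ) ^ γ) :
    IsYoungIntegral f w s t I :=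
  tendsto_iff_norm_sub_tendsto_zero.2 <|
    squeeze_zero (fun _ => norm_nonneg _) h (tendsto_mesh_rpow s t hγ C)

theorem isYoungLoveConstant_sewingConst {α β : ℝ≥0} (hαβ : 1 < α + β) :
    IsYoungLoveConstant α β (sewingConst (α + β)) := by
  have hθ : 1 < (α : ℝ) + β := by exact_mod_cast hαβ
  refine ⟨by linarith [two_le_sewingConst hθ], fun e d T f w hf hw s t hst => ?_⟩
  obtain ⟨I, h1, h2⟩ := exists_young hαβ hf.holderWith hw.holderWith hst.le
  have hI := isYoungIntegral_of_rate (by linarith) h1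
  refine ⟨I, hI, fun I' hI' => hI'.unique hst hI, h2.trans_eq ?_⟩
  ring

lemma IsYoungIntegral.sub_right {f : Set.Icc (0 : ℝ) T → Mat e d}
    {w w' : Set.Icc (0 : ℝ) T → Vec d} {s t : Set.Icc (0 : ℝ) T} {I I' : Vec e}
    (h : IsYoungIntegral f w s t I) (h' : IsYoungIntegral f w' s t I') :
    IsYoungIntegral f (w - w') s t (I - I') := by
  refine (Tendsto.sub h h').congr fun D => ?_
  rw [youngSum, youngSum, youngSum, ← Finset.sum_sub_distrib]
  refine Finset.sum_congr rfl fun i _ => ?_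
  simp only [Pi.sub_apply, Mat.apply_sub_right]
  abel

lemma IsYoungIntegral.combination {f g : Set.Icc (0 : ℝ) T → Mat e d}
    {w : Set.Icc (0 : ℝ) T → Vec d} {s t : Set.Icc (0 : ℝ) T} {I I' : Vec e} (a b : ℝ)
    (h : IsYoungIntegral f w s t I) (h' : IsYoungIntegral g w s t I') :
    IsYoungIntegral (a • f + b • g) w s t (a • I + b • I') := by
  refine (Tendsto.add (h.const_smul a) (h'.const_smul b)).congr fun D => ?_
  rw [youngSum, youngSum, youngSum, Finset.smul_sum, Finset.smul_sum, ← Finset.sum_add_distrib]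
  refine Finset.sum_congr rfl fun i _ => ?_
  rw [← Mat.apply_combination]
  rfl

lemma continuous_youngSum (w : Set.Icc (0 : ℝ) T → Vec d) {s t : Set.Icc (0 : ℝ) T}
    (D : Dissection s t) : Continuous fun f : Set.Icc (0 : ℝ) T → Mat e d => youngSum f w D :=
  continuous_finsetSum _ fun _ _ => (Mat.continuous_apply _).comp (continuous_apply _)

end Young

/-! ### Hölder selections -/

section Selections

variable {T : ℝ} {ι : Type} [Fintype ι]

lemma eHolderNorm_le_iff {X Y : Type*} [MetricSpace X] [EMetricSpace Y] {α r : ℝ≥0} {f : X → Y} :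
    eHolderNorm α f ≤ r ↔ HolderWith r α f := by
  refine ⟨fun h => ?_, fun h => h.eHolderNorm_le⟩
  have hf : MemHolder α f := eHolderNorm_ne_top.1 (h.trans_lt ENNReal.coe_lt_top).ne
  refine hf.holderWith.mono ?_
  rwa [← ENNReal.coe_le_coe, hf.coe_nnHolderNorm_eq_eHolderNorm]

/-- Hölder functions of positive exponent are continuous, so measurability is automatic. -/
lemma mem_selections_iff {α r : ℝ≥0} (hα : 0 < α)
    {F : Set.Icc (0 : ℝ) T → ConvexBody (EuclideanSpace ℝ ι)}
    {f : Set.Icc (0 : ℝ) T → EuclideanSpace ℝ ι} :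
    f ∈ selections α r F ↔ (∀ t, f t ∈ F t) ∧ HolderWith r α f := by
  rw [selections, Set.mem_ofPred_eq, eHolderNorm_le_iff]
  exact ⟨fun h => h.2, fun h => ⟨(h.2.continuous hα).measurable, h⟩⟩

lemma selections_nonempty {α r : ℝ≥0} (hα : 0 < α)
    {F : Set.Icc (0 : ℝ) T → ConvexBody (EuclideanSpace ℝ ι)} (hF : MemHolder α F)
    (hr : rMin α F ≤ r) : (selections α r F).Nonempty :=
  ⟨_, (mem_selections_iff hα).2 ⟨fun t => steinerPt_mem (F t), holderWith_steinerPt hF hr⟩⟩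

lemma convex_selections {α : ℝ≥0} (hα : 0 < α) (r : ℝ≥0)
    (F : Set.Icc (0 : ℝ) T → ConvexBody (EuclideanSpace ℝ ι)) : Convex ℝ (selections α r F) := by
  intro f hf g hg a b ha hb hab
  rw [mem_selections_iff hα] at hf hg ⊢
  refine ⟨fun t => (F t).convex (hf.1 t) (hg.1 t) ha hb hab, ?_⟩
  refine ((hf.2.smul a).add (hg.2.smul b)).mono (le_of_eq ?_)
  ext
  push_cast
  rw [Real.norm_of_nonneg ha, Real.norm_of_nonneg hb, ← mul_add, hab, mul_one]

/-- The set of Hölder selections is compact for pointwise convergence. -/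
lemma isCompact_selections {α : ℝ≥0} (hα : 0 < α) (r : ℝ≥0)
    (F : Set.Icc (0 : ℝ) T → ConvexBody (EuclideanSpace ℝ ι)) :
    IsCompact (selections α r F) := by
  have h : selections α r F = Set.univ.pi (fun t => (F t : Set (EuclideanSpace ℝ ι))) ∩
      {f | HolderWith r α f} := by
    ext f
    rw [mem_selections_iff hα]
    simp
  rw [h]
  -- Tychonoff gives compactness of the product of the values; each Hölder inequality is a closed
  -- condition on two coordinates.
  refine (isCompact_univ_pi fun t => (F t).isCompact).inter_right ?_
  simp only [HolderWith, Set.ofPred_forall]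
  exact isClosed_iInter fun s => isClosed_iInter fun t =>
    isClosed_le ((continuous_apply s).edist (continuous_apply t)) continuous_const

lemma norm_le_dist_zero {C : ConvexBody (EuclideanSpace ℝ ι)} {x : EuclideanSpace ℝ ι}
    (hx : x ∈ C) : ‖x‖ ≤ dist C 0 := by
  have h := Metric.infDist_le_hausdorffDist_of_mem (s := (C : Set (EuclideanSpace ℝ ι)))
    (t := ((0 : ConvexBody (EuclideanSpace ℝ ι)) : Set (EuclideanSpace ℝ ι))) hx
    ConvexBody.hausdorffEDist_ne_top
  rw [ConvexBody.hausdorffDist_coe] at h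
  rwa [ConvexBody.coe_zero, ← Set.singleton_zero, Metric.infDist_singleton, dist_zero_right] at h

/-- A real supremum needs a bound, supplied by continuity of `F` on a compact interval. -/
lemma dist_zero_le_supNorm {α : ℝ≥0} (hα : 0 < α)
    {F : Set.Icc (0 : ℝ) T → ConvexBody (EuclideanSpace ℝ ι)} (hF : MemHolder α F)
    (t : Set.Icc (0 : ℝ) T) : dist (F t) 0 ≤ supNorm F :=
  le_ciSup (f := fun t => dist (F t) 0)
    (isCompact_range ((hF.holderWith.continuous hα).dist continuous_const)).bddAbove t

end Selections

/-! ### The Aumann-Young integral -/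

section Main

variable {T : ℝ} {e d : ℕ} {α β r : ℝ≥0} {F : Set.Icc (0 : ℝ) T → ConvexBody (Mat e d)}

lemma convex_aumannYoung (hT : 0 ≤ T) (hα : 0 < α) (w : Set.Icc (0 : ℝ) T → Vec d) :
    Convex ℝ (aumannYoung hT α r F w) := by
  rintro _ ⟨f, hf, hI⟩ _ ⟨g, hg, hI'⟩ a b ha hb hab
  exact ⟨a • f + b • g, convex_selections hα r F hf hg ha hb hab, hI.combination a b hI'⟩

lemma aumannYoung_nonempty (hT : 0 ≤ T) (hα : 0 < α) (hαβ : 1 < α + β)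
    (hF : MemHolder α F) (hr : rMin α F ≤ r) {w : Set.Icc (0 : ℝ) T → Vec d}
    (hw : MemHolder β w) : (aumannYoung hT α r F w).Nonempty := by
  obtain ⟨f, hf⟩ := selections_nonempty hα hF hr
  have hθ : 1 < (α : ℝ) + β := by exact_mod_cast hαβ
  obtain ⟨I, h1, -⟩ := exists_young hαβ ((mem_selections_iff hα).1 hf).2 hw.holderWith
    (s := ⟨0, le_rfl, hT⟩) (t := ⟨T, hT, le_rfl⟩) hT
  exact ⟨I, f, hf, isYoungIntegral_of_rate (by linarith) h1⟩

/-- The Young integral is continuous on the compact set of selections, as a uniform limit of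
Riemann sums. -/
lemma isCompact_aumannYoung (hT : 0 < T) (hα : 0 < α) (hαβ : 1 < α + β)
    {w : Set.Icc (0 : ℝ) T → Vec d} (hw : MemHolder β w) :
    IsCompact (aumannYoung hT.le α r F w) := by
  have hθ : 1 < (α : ℝ) + β := by exact_mod_cast hαβ
  set o : Set.Icc (0 : ℝ) T := ⟨0, le_rfl, hT.le⟩ with ho
  set τ : Set.Icc (0 : ℝ) T := ⟨T, hT.le, le_rfl⟩ with hτ
  have hoτ : o < τ := hT
  -- The rate involves `r` and not the Hölder constant of the individual `f`, hence is uniform over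
  -- the selections.
  have hex : ∀ f ∈ selections α r F, ∃ I : Vec e, ∀ D : Dissection o τ, ‖youngSum f w D - I‖ ≤
      sewingConst (α + β) * (r * nnHolderNorm β w) * ((τ : ℝ) - o) *
        (D.mesh : ℝ) ^ ((α : ℝ) + β - 1) := fun f hf =>
    (exists_young hαβ ((mem_selections_iff hα).1 hf).2 hw.holderWith hoτ.le).imp fun _ h => h.1
  choose! I hI using hex
  have heq : aumannYoung hT.le α r F w = I '' selections α r F := by
    ext x
    constructor
    · rintro ⟨f, hf, hx⟩
      exact ⟨f, hf, (isYoungIntegral_of_rate (by linarith) (hI f hf)).unique hoτ hx⟩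
    · rintro ⟨f, hf, rfl⟩
      exact ⟨f, hf, isYoungIntegral_of_rate (by linarith) (hI f hf)⟩
  rw [heq]
  refine (isCompact_selections hα r F).image_of_continuousOn ?_
  have := meshFilter_neBot hoτ
  have hunif : TendstoUniformlyOn (fun (D : Dissection o τ) f => youngSum f w D) I
      (meshFilter o τ) (selections α r F) := by
    rw [Metric.tendstoUniformlyOn_iff]
    intro ε hε
    filter_upwards [(tendsto_mesh_rpow o τ (sub_pos.2 hθ) _).eventually_lt_const hε] with D hD f hf
    rw [dist_comm, dist_eq_norm]
    exact (hI f hf D).trans_lt hD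
  exact hunif.continuousOn (Frequently.of_forall fun D => (continuous_youngSum w D).continuousOn)

/-- The integrals of a selection with respect to two drivers are close. -/
lemma dist_integral_le (hT : 0 < T) (hα : 0 < α) (hαβ : 1 < α + β) (hF : MemHolder α F)
    {f : Set.Icc (0 : ℝ) T → Mat e d} (hf : f ∈ selections α r F)
    {w₁ w₂ : Set.Icc (0 : ℝ) T → Vec d} (hw : MemHolder β (w₁ - w₂)) {x y : Vec e}
    (hx : IsYoungIntegral f w₁ ⟨0, le_rfl, hT.le⟩ ⟨T, hT.le, le_rfl⟩ x)
    (hy : IsYoungIntegral f w₂ ⟨0, le_rfl, hT.le⟩ ⟨T, hT.le, le_rfl⟩ y) :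
    dist x y ≤ sewingConst (α + β) * T ^ (β : ℝ) * max (T ^ (α : ℝ)) 1 * (r + supNorm F) *
      nnHolderNorm β (w₁ - w₂) := by
  have hθ : 1 < (α : ℝ) + β := by exact_mod_cast hαβ
  obtain ⟨hfF, hfr⟩ := (mem_selections_iff hα).1 hf
  set o : Set.Icc (0 : ℝ) T := ⟨0, le_rfl, hT.le⟩ with ho
  set τ : Set.Icc (0 : ℝ) T := ⟨T, hT.le, le_rfl⟩ with hτ
  have hoτ : o < τ := hT
  obtain ⟨I, h1, h2⟩ := exists_young hαβ hfr hw.holderWith hoτ.le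
  have hI : I = x - y :=
    (isYoungIntegral_of_rate (by linarith) h1).unique hoτ (hx.sub_right hy)
  have hTo : (τ : ℝ) - o = T := sub_zero T
  have h3 := norm_sub_le_of_holderWith hw.holderWith hoτ.le
  have h4 := (Mat.norm_apply_le (f o) ((w₁ - w₂) τ - (w₁ - w₂) o))
  have h5 : ‖f o‖ ≤ supNorm F := (norm_le_dist_zero (hfF o)).trans (dist_zero_le_supNorm hα hF o)
  have hN : 0 ≤ supNorm F := (norm_nonneg _).trans h5
  have hK := two_le_sewingConst hθ
  rw [hTo] at h2 h3
  rw [dist_eq_norm, ← hI]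
  set H : ℝ := (nnHolderNorm β (w₁ - w₂) : ℝ) with hH
  have hH0 : 0 ≤ H := NNReal.coe_nonneg _
  have hb : 0 ≤ T ^ (β : ℝ) := by positivity
  have ha : T ^ (α : ℝ) ≤ max (T ^ (α : ℝ)) 1 := le_max_left _ _
  have hm : 1 ≤ max (T ^ (α : ℝ)) 1 := le_max_right _ _
  set m := max (T ^ (α : ℝ)) 1
  rw [Real.rpow_add hT] at h2
  have hr := r.coe_nonneg
  calc ‖I‖ ≤ ‖I - (f o).apply ((w₁ - w₂) τ - (w₁ - w₂) o)‖ +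
        ‖(f o).apply ((w₁ - w₂) τ - (w₁ - w₂) o)‖ := by
        simpa using norm_add_le (I - (f o).apply ((w₁ - w₂) τ - (w₁ - w₂) o))
          ((f o).apply ((w₁ - w₂) τ - (w₁ - w₂) o))
    _ ≤ sewingConst (α + β) * (r * H) * (T ^ (α : ℝ) * T ^ (β : ℝ)) +
        supNorm F * (H * T ^ (β : ℝ)) :=
        add_le_add h2 (h4.trans (mul_le_mul h5 h3 (norm_nonneg _) hN))
    -- Both `T ^ α ≤ m` and `1 ≤ sewingConst (α + β) * m` hold, so the two terms share a common
    -- factor.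
    _ ≤ sewingConst (α + β) * (r * H) * (m * T ^ (β : ℝ)) +
        (sewingConst (α + β) * m) * (supNorm F * (H * T ^ (β : ℝ))) := by
        refine add_le_add (by gcongr) (le_mul_of_one_le_left (by positivity)
          (one_le_mul_of_one_le_of_one_le (by linarith) hm))
    _ = _ := by ring

end Main

end AumannYoung

end

theorem mainTheorem6 (α β : ℝ≥0) (hα₀ : 0 < α) (hα₁ : α ≤ 1) (hβ₀ : 0 < β) (hβ₁ : β ≤ 1)
    (hαβ : 1 < α + β) :
    ∃ c : ℝ, AumannYoung.IsYoungLoveConstant α β c ∧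
      ∀ (e d : ℕ) (T : ℝ) (hT : 0 < T)
        (F : Set.Icc (0 : ℝ) T → ConvexBody (AumannYoung.Mat e d)), MemHolder α F →
        ∀ r : ℝ≥0, AumannYoung.rMin α F ≤ (r : ℝ≥0∞) →
          ∃ J : {w : Set.Icc (0 : ℝ) T → AumannYoung.Vec d // MemHolder β w} →
              ConvexBody (AumannYoung.Vec e),
            (∀ w, (J w : Set (AumannYoung.Vec e)) =
              AumannYoung.aumannYoung hT.le α r F w.1) ∧
            ∀ w₁ w₂,
              dist (J w₁) (J w₂) ≤
                c * T ^ (β : ℝ) * max (T ^ (α : ℝ)) 1 * (r + AumannYoung.supNorm F) *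
                  nnHolderNorm β (w₁.1 - w₂.1) ∧
              dist (J w₁) (J w₂) ≤
                c * T ^ (β : ℝ) * max (T ^ (α : ℝ)) 1 * (r + AumannYoung.supNorm F) *
                  AumannYoung.holderFullNorm β (w₁.1 - w₂.1) := by
  have hθ : 1 < (α : ℝ) + β := by exact_mod_cast hαβ
  refine ⟨AumannYoung.sewingConst (α + β), AumannYoung.isYoungLoveConstant_sewingConst hαβ,
    fun e d T hT F hF r hr => ?_⟩
  refine ⟨fun w => ⟨AumannYoung.aumannYoung hT.le α r F w.1,
    AumannYoung.convex_aumannYoung hT.le hα₀ w.1,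
    AumannYoung.isCompact_aumannYoung hT hα₀ hαβ w.2,
    AumannYoung.aumannYoung_nonempty hT.le hα₀ hαβ hF hr w.2⟩, fun w => rfl, fun w₁ w₂ => ?_⟩
  have hw : MemHolder β (w₁.1 - w₂.1) := by
    have h := w₁.2.add (w₂.2.smul (c := (-1 : ℝ)))
    rwa [neg_one_smul, ← sub_eq_add_neg] at h
  have hN : 0 ≤ AumannYoung.supNorm F :=
    dist_nonneg.trans (AumannYoung.dist_zero_le_supNorm hα₀ hF ⟨0, le_rfl, hT.le⟩)
  have hK := AumannYoung.two_le_sewingConst hθ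
  have hex : ∀ w : {w : Set.Icc (0 : ℝ) T → AumannYoung.Vec d // MemHolder β w},
      ∀ f ∈ AumannYoung.selections α r F, ∃ y, AumannYoung.IsYoungIntegral f w.1
        ⟨0, le_rfl, hT.le⟩ ⟨T, hT.le, le_rfl⟩ y := fun w f hf => by
    obtain ⟨y, hy, -⟩ := (AumannYoung.isYoungLoveConstant_sewingConst hαβ).2 e d T f w.1
      ((AumannYoung.mem_selections_iff hα₀).1 hf).2.memHolder w.2
      ⟨0, le_rfl, hT.le⟩ ⟨T, hT.le, le_rfl⟩ hT
    exact ⟨y, hy⟩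
  -- The bound with the full norm follows from the seminorm bound, since the sup norm is
  -- nonnegative.
  suffices hmain : Metric.hausdorffDist (AumannYoung.aumannYoung hT.le α r F w₁.1)
      (AumannYoung.aumannYoung hT.le α r F w₂.1) ≤
        AumannYoung.sewingConst (α + β) * T ^ (β : ℝ) * max (T ^ (α : ℝ)) 1 *
          (r + AumannYoung.supNorm F) * nnHolderNorm β (w₁.1 - w₂.1) from
    ⟨hmain, hmain.trans (mul_le_mul_of_nonneg_left (le_add_of_nonneg_left
      (Real.iSup_nonneg fun t => norm_nonneg ((w₁.1 - w₂.1) t))) (by positivity))⟩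
  -- A point of either set is matched with the integral of the same selection against the other
  -- driver.
  refine Metric.hausdorffDist_le_of_mem_dist (by positivity) ?_ ?_
  · rintro x ⟨f, hf, hx⟩
    obtain ⟨y, hy⟩ := hex w₂ f hf
    exact ⟨y, ⟨f, hf, hy⟩, AumannYoung.dist_integral_le hT hα₀ hαβ hF hf hw hx hy⟩
  · rintro y ⟨f, hf, hy⟩
    obtain ⟨x, hx⟩ := hex w₁ f hf
    refine ⟨x, ⟨f, hf, hx⟩, ?_⟩
    rw [dist_comm]
    exact AumannYoung.dist_integral_le hT hα₀ hαβ hF hf hw hx hy
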